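/- For graphs $G$ and $H$, let $G \vee H$ denote their join (disjoint copies of $G$ and $H$ together with all edges between them), let $\chi(G)$ be the chromatic number of $G$, and let $\chi_\ell(G)$ be the list chromatic number, i.e. the smallest $k$ such that, whenever every vertex $v$ of $G$ is given a list $L(v)$ of exactly $k$ colors, $G$ has a proper coloring $f$ with $f(v) \in L(v)$ for all $v$. For positive integers $a \le b$ and an integer $s \ge 0$, let $\tau_s(a,b)$ be the smallest integer $n \ge 0$ such that $$\chi_\ell(K_n \vee K_{a,b}) - \chi(K_n \vee K_{a,b}) \le s,$$ where $K_0 \vee K_{a,b} = K_{a,b}$ (this is the $s$-th generalized Ohba number of the complete bipartite graph $K_{a,b}$). Theorem. Let $s, l, a$ be nonnegative integers such that $l \ge 2$, $a > s+2$, and $(a-s-1)$ divides $(l+s+1)$. Let $q = (l+s+1)/(a-s-1)$. If $b$ is an integer with $b \ge a$ and $$b \ge (l+s+1)^s \left( \binom{l+s+1}{l+1} + \binom{l+s+1}{l}\, q \right),$$ then $\tau_s(a,b) \ge l$. -/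

import Mathlib

/-- The join `G ∨ H`: disjoint copies of `G` and `H`, with every vertex of `G` adjacent to every
vertex of `H`. -/
def graphJoin {V W : Type*} (G : SimpleGraph V) (H : SimpleGraph W) : SimpleGraph (V ⊕ W) where
  Adj
    | Sum.inl u, Sum.inl v => G.Adj u v
    | Sum.inr u, Sum.inr v => H.Adj u v
    | Sum.inl _, Sum.inr _ => True
    | Sum.inr _, Sum.inl _ => True
  symm := ⟨by
    rintro (u | u) (v | v) h
    · exact G.adj_symm h
    · trivial
    · trivial
    · exact H.adj_symm h⟩
  loopless := ⟨by
    rintro (u | u) h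
    · exact G.loopless.irrefl u h
    · exact H.loopless.irrefl u h⟩

/-- `G` is `L`-colorable: there is a proper coloring `f` of `G` with `f v ∈ L v` for every vertex
`v`. Colors are natural numbers. -/
def IsListColorable {V : Type*} (G : SimpleGraph V) (L : V → Finset ℕ) : Prop :=
  ∃ f : G.Coloring ℕ, ∀ v, f v ∈ L v

/-- `L` is a `k`-assignment: every list has exactly `k` colors. -/
def IsKAssignment {V : Type*} (k : ℕ) (L : V → Finset ℕ) : Prop :=
  ∀ v, (L v).card = k

/-- The list chromatic number: the smallest `k` such that `G` is `L`-colorable for every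
`k`-assignment `L`. As for `SimpleGraph.chromaticNumber`, the value lies in `ℕ∞`
(it is finite for finite graphs). -/
noncomputable def listChromaticNumber {V : Type*} (G : SimpleGraph V) : ℕ∞ :=
  ⨅ k ∈ {k : ℕ | ∀ L : V → Finset ℕ, IsKAssignment k L → IsListColorable G L}, (k : ℕ∞)

/-- The `s`-th generalized Ohba number of `G` (the Ohba number for `s = 0`): the smallest `n : ℕ`
with `χ_ℓ(K_n ∨ G) - χ(K_n ∨ G) ≤ s`, where the inequality is written without subtraction.
For `n = 0` the graph `K_0 ∨ G` is a copy of `G`, so the value is `0` when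
`χ_ℓ(G) - χ(G) ≤ s`. It is the infimum in `ℕ∞` of the set of admissible `n`, so that it is
the smallest admissible `n` and never a default value `0`. -/
noncomputable def generalizedOhbaNumber {V : Type*} (s : ℕ) (G : SimpleGraph V) : ℕ∞ :=
  ⨅ n ∈ {n : ℕ |
      listChromaticNumber (graphJoin (⊤ : SimpleGraph (Fin n)) G) ≤
        (graphJoin (⊤ : SimpleGraph (Fin n)) G).chromaticNumber + (s : ℕ∞)}, (n : ℕ∞)

/-- `τ_s(a, b)`: the `s`-th generalized Ohba number of the complete bipartite graph `K_{a,b}`. -/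
noncomputable def ohbaTau (s a b : ℕ) : ℕ∞ :=
  generalizedOhbaNumber s (completeBipartiteGraph (Fin a) (Fin b))

/-! Put k = l+s+1 and m = a-s-1, so k = mq. If some n < l were admissible, K_n ∨ K_{a,b} would be
(n+2+s)-choosable, since its chromatic number is at most n+2. Each new dominating vertex costs at
most one color (`IsChoosable.join_top_succ`), so K_{l-1} ∨ K_{a,b} would be k-choosable.

Bad lists refute this. The clique and one small-side vertex take l distinct colors of an m × q grid.
Each of m further small-side vertices sees the grid with one row replaced by q extra colors; the one
missing the row of that vertex's color adds either another grid color or an extra color. The last s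
small-side vertices take one color from each of s private grids. The large side carries every k-set
of these shapes, so one of its lists is exhausted (`exists_largeSideList_used`). -/

/-- `G` is `k`-choosable: it is `L`-colorable for every `k`-assignment `L`. -/
def IsChoosable {V : Type*} (G : SimpleGraph V) (k : ℕ) : Prop :=
  ∀ L : V → Finset ℕ, IsKAssignment k L → IsListColorable G L

theorem IsChoosable.mono {V : Type*} {G : SimpleGraph V} {k k' : ℕ} (h : IsChoosable G k)
    (hk : k ≤ k') : IsChoosable G k' := by
  intro L hL
  have hsub : ∀ v, ∃ T ⊆ L v, T.card = k := fun v =>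
    Finset.exists_subset_card_eq (by rw [hL v]; exact hk)
  choose T hT hTk using hsub
  obtain ⟨f, hf⟩ := h T hTk
  exact ⟨f, fun v => hT v (hf v)⟩

theorem isChoosable_of_listChromaticNumber_le {V : Type*} {G : SimpleGraph V} {k : ℕ}
    (h : listChromaticNumber G ≤ k) : IsChoosable G k := by
  have hlt : listChromaticNumber G < ((k + 1 : ℕ) : ℕ∞) :=
    lt_of_le_of_lt h (by exact_mod_cast Nat.lt_succ_self k)
  unfold listChromaticNumber at hlt
  simp only [iInf_lt_iff] at hlt
  obtain ⟨k', hk', hlt⟩ := hlt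
  have hlt' : k' < k + 1 := by exact_mod_cast hlt
  exact IsChoosable.mono hk' (by omega)

/-- A list assignment with colors in a countable type witnesses non-choosability. -/
theorem IsChoosable.exists_coloring {V Γ : Type*} [Countable Γ] {G : SimpleGraph V} {k : ℕ}
    (h : IsChoosable G k) (L : V → Finset Γ) (hL : ∀ v, (L v).card = k) :
    ∃ g : V → Γ, (∀ v, g v ∈ L v) ∧ ∀ u v, G.Adj u v → g u ≠ g v := by
  obtain ⟨e, he⟩ := exists_injective_nat Γ
  obtain ⟨f, hf⟩ := h (fun v => (L v).map ⟨e, he⟩) (fun v => by simp [hL v])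
  have hf' : ∀ v, ∃ c ∈ L v, e c = f v := fun v => by simpa using hf v
  choose g hg hgf using hf'
  exact ⟨g, hg, fun u v huv hc => f.valid huv (by rw [← hgf u, ← hgf v, hc])⟩

/-- Adding one dominating vertex raises choosability by at most one. -/
theorem IsChoosable.join_top_succ {V : Type*} {G : SimpleGraph V} {n k : ℕ}
    (h : IsChoosable (graphJoin (⊤ : SimpleGraph (Fin n)) G) k) :
    IsChoosable (graphJoin (⊤ : SimpleGraph (Fin (n + 1))) G) (k + 1) := by
  intro L hL
  obtain ⟨c, hc⟩ : (L (Sum.inl 0)).Nonempty := by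
    rw [← Finset.card_pos, hL]; omega
  -- Reserve `c` for the new vertex `0`; every other list loses at most one color.
  have hsub : ∀ v : Fin n ⊕ V, ∃ T ⊆ (L (Sum.map Fin.succ id v)).erase c, T.card = k := by
    intro v
    apply Finset.exists_subset_card_eq
    have := Finset.pred_card_le_card_erase (s := L (Sum.map Fin.succ id v)) (a := c)
    rw [hL] at this
    simpa using this
  choose T hT hTk using hsub
  obtain ⟨f, hf⟩ := h T hTk
  have hfL : ∀ v, f v ≠ c ∧ f v ∈ L (Sum.map Fin.succ id v) := fun v =>
    Finset.mem_erase.1 (hT v (hf v))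
  refine ⟨SimpleGraph.Coloring.mk
    (Sum.elim (Fin.cases c fun i => f (Sum.inl i)) fun v => f (Sum.inr v)) ?_, ?_⟩
  · rintro (u | u) (v | v) huv
    · induction u using Fin.cases with
      | zero =>
        induction v using Fin.cases with
        | zero => exact absurd rfl huv
        | succ j => exact (hfL (Sum.inl j)).1.symm
      | succ i =>
        induction v using Fin.cases with
        | zero => exact (hfL (Sum.inl i)).1
        | succ j =>
          exact f.valid (v := Sum.inl i) (w := Sum.inl j)
            (show i ≠ j from fun hij => huv (by rw [hij]))
    · induction u using Fin.cases with
      | zero => exact (hfL (Sum.inr v)).1.symm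
      | succ i => exact f.valid (v := Sum.inl i) (w := Sum.inr v) trivial
    · induction v using Fin.cases with
      | zero => exact (hfL (Sum.inr u)).1
      | succ j => exact f.valid (v := Sum.inr u) (w := Sum.inl j) trivial
    · exact f.valid (v := Sum.inr u) (w := Sum.inr v) huv
  · rintro (u | u)
    · induction u using Fin.cases with
      | zero => exact hc
      | succ i => exact (hfL (Sum.inl i)).2
    · exact (hfL (Sum.inr u)).2

theorem IsChoosable.join_top_add {V : Type*} {G : SimpleGraph V} {n k : ℕ}
    (h : IsChoosable (graphJoin (⊤ : SimpleGraph (Fin n)) G) k) (d : ℕ) :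
    IsChoosable (graphJoin (⊤ : SimpleGraph (Fin (n + d))) G) (k + d) := by
  induction d with
  | zero => exact h
  | succ d ih => exact ih.join_top_succ

theorem chromaticNumber_join_top_completeBipartiteGraph_le (n : ℕ) (V W : Type*) :
    (graphJoin (⊤ : SimpleGraph (Fin n)) (completeBipartiteGraph V W)).chromaticNumber
      ≤ (n : ℕ∞) + 2 := by
  have hcol : (graphJoin (⊤ : SimpleGraph (Fin n)) (completeBipartiteGraph V W)).Coloring
      (Fin n ⊕ Bool) := SimpleGraph.Coloring.mk (Sum.map id Sum.isLeft) (by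
    rintro (u | u | u) (v | v | v) huv <;>
      simp_all [graphJoin, completeBipartiteGraph])
  have := hcol.colorable.chromaticNumber_le
  simpa using this

/-! ### Bad lists on K_{l-1} ∨ K_{a,b} -/

section LowerBound

/-- The colors: a grid `Fin m × Fin q`, one extra palette `Fin q`, and `s` disjoint copies of
the grid. -/
abbrev OhbaColor (s m q : ℕ) : Type :=
  (Fin m × Fin q) ⊕ (Fin q ⊕ (Fin s × (Fin m × Fin q)))

/-- The lists on the smaller side: `s` disjoint grids, the basic grid, and for every row of the
basic grid the list in which this row is replaced by the extra palette. -/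
def smallSideList (s m q : ℕ) : Fin s ⊕ (Unit ⊕ Fin m) → Finset (OhbaColor s m q)
  | Sum.inl i => (∅ : Finset _).disjSum ((∅ : Finset _).disjSum ({i} ×ˢ Finset.univ))
  | Sum.inr (Sum.inl _) => Finset.univ.disjSum ∅
  | Sum.inr (Sum.inr j) => ({j}ᶜ ×ˢ Finset.univ).disjSum (Finset.univ.disjSum ∅)

/-- The index type of the lists on the larger side. -/
abbrev LargeSideIndex (s l m q : ℕ) : Type :=
  (Fin s → Fin m × Fin q) ×
    ({S : Finset (Fin m × Fin q) // S.card = l + 1} ⊕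
      ({S : Finset (Fin m × Fin q) // S.card = l} × Fin q))

/-- The part of a list on the larger side that lies in the basic grid. -/
def LargeSideIndex.grid {s l m q : ℕ} (t : LargeSideIndex s l m q) : Finset (Fin m × Fin q) :=
  Sum.elim (fun S => S.1) (fun p => p.1.1) t.2

/-- The part of a list on the larger side that lies in the extra palette. -/
def LargeSideIndex.extra {s l m q : ℕ} (t : LargeSideIndex s l m q) : Finset (Fin q) :=
  Sum.elim (fun _ => ∅) (fun p => {p.2}) t.2

/-- The lists on the larger side. -/
def largeSideList {s l m q : ℕ} (t : LargeSideIndex s l m q) : Finset (OhbaColor s m q) :=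
  t.grid.disjSum (t.extra.disjSum
    (Finset.univ.map ⟨fun i => (i, t.1 i), fun _ _ h => congrArg Prod.fst h⟩))

theorem card_smallSideList {s m q : ℕ} (x : Fin s ⊕ (Unit ⊕ Fin m)) :
    (smallSideList s m q x).card = m * q := by
  rcases x with i | _ | j
  · simp [smallSideList]
  · simp [smallSideList]
  · have hm : m - 1 + 1 = m := Nat.sub_add_cancel j.pos
    simp only [smallSideList, Finset.card_disjSum, Finset.card_product, Finset.card_compl,
      Finset.card_singleton, Finset.card_univ, Fintype.card_fin, Finset.card_empty, add_zero]
    rw [← Nat.succ_mul, Nat.succ_eq_add_one, hm]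

theorem card_largeSideList {s l m q : ℕ} (t : LargeSideIndex s l m q) :
    (largeSideList t).card = l + s + 1 := by
  obtain ⟨γ, ⟨S, hS⟩ | ⟨⟨S, hS⟩, c⟩⟩ := t <;>
    simp [largeSideList, LargeSideIndex.grid, LargeSideIndex.extra, hS] <;> omega

/-- With `m * q = l + s + 1` this is exactly the bound imposed on `b`. -/
theorem card_largeSideIndex (s l m q : ℕ) :
    Fintype.card (LargeSideIndex s l m q) =
      (m * q) ^ s * ((m * q).choose (l + 1) + (m * q).choose l * q) := by
  simp [LargeSideIndex, Fintype.card_finset_len]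

/-- If every coloring from the lists `smallSideList` and the full grids on a clique of order
`l - 1` is given, then some list `largeSideList t` consists of used colors. -/
theorem exists_largeSideList_used {s l m q : ℕ} (hl : 1 ≤ l)
    (gu : Fin (l - 1) → OhbaColor s m q) (gx : Fin s ⊕ (Unit ⊕ Fin m) → OhbaColor s m q)
    (hu : ∀ i, gu i ∈ (Finset.univ : Finset (Fin m × Fin q)).disjSum ∅)
    (hx : ∀ x, gx x ∈ smallSideList s m q x) (huu : Function.Injective gu)
    (hux : ∀ i x, gu i ≠ gx x) :
    ∃ t : LargeSideIndex s l m q, ∀ c ∈ largeSideList t, (∃ i, gu i = c) ∨ ∃ x, gx x = c := by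
  classical
  have hα : ∀ i, ∃ p, gu i = Sum.inl p := fun i => by
    have := hu i
    rcases h : gu i with p | p
    · exact ⟨p, rfl⟩
    · simp [h] at this
  choose α hα using hα
  have hβ : ∃ p, gx (Sum.inr (Sum.inl ())) = Sum.inl p := by
    have := hx (Sum.inr (Sum.inl ()))
    rcases h : gx (Sum.inr (Sum.inl ())) with p | p
    · exact ⟨p, rfl⟩
    · simp [h, smallSideList] at this
  obtain ⟨β, hβ⟩ := hβ
  have hγ : ∀ i : Fin s, ∃ p, gx (Sum.inl i) = Sum.inr (Sum.inr (i, p)) := fun i => by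
    have := hx (Sum.inl i)
    rcases h : gx (Sum.inl i) with p | p | ⟨i', p⟩
    · simp [h, smallSideList] at this
    · simp [h, smallSideList] at this
    · simp only [h, smallSideList, Finset.inr_mem_disjSum, Finset.mem_product,
        Finset.mem_singleton] at this
      exact ⟨p, by rw [this.1]⟩
  choose γ hγ using hγ
  have hαinj : Function.Injective α := fun i j hij => huu (by rw [hα, hα, hij])
  set U : Finset (Fin m × Fin q) := Finset.univ.image α with hU
  have hUcard : U.card = l - 1 := by simp [hU, Finset.card_image_of_injective _ hαinj]
  have hβU : β ∉ U := by
    intro h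
    obtain ⟨i, -, hi⟩ := Finset.mem_image.1 h
    exact hux i _ (by rw [hα, hβ, hi])
  have hcard : (insert β U).card = l := by
    rw [Finset.card_insert_of_notMem hβU, hUcard]; omega
  have hUused : ∀ p ∈ insert β U,
      (∃ i, gu i = Sum.inl p) ∨ ∃ x, gx x = (Sum.inl p : OhbaColor s m q) := by
    intro p hp
    rcases Finset.mem_insert.1 hp with rfl | hp
    · exact Or.inr ⟨_, hβ⟩
    · obtain ⟨i, -, rfl⟩ := Finset.mem_image.1 hp
      exact Or.inl ⟨i, hα i⟩
  -- This list omits the row of `β`, so its vertex cannot reuse `β`; the clique colors are barred by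
  -- adjacency.
  have hrow := hx (Sum.inr (Sum.inr β.1))
  rcases h : gx (Sum.inr (Sum.inr β.1)) with δ | c | p
  · have hδ : δ.1 ≠ β.1 := by simpa [h, smallSideList] using hrow
    have hδU : δ ∉ insert β U := by
      intro hmem
      rcases Finset.mem_insert.1 hmem with rfl | hmem
      · exact hδ rfl
      · obtain ⟨i, -, rfl⟩ := Finset.mem_image.1 hmem
        exact hux i _ (by rw [hα, h])
    refine ⟨(γ, Sum.inl ⟨insert δ (insert β U), by
      rw [Finset.card_insert_of_notMem hδU, hcard]⟩), ?_⟩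
    rintro (p | c | p) hp
    · rcases Finset.mem_insert.1 (Finset.inl_mem_disjSum.1 hp) with rfl | hp
      · exact Or.inr ⟨_, h⟩
      · exact hUused p hp
    · simp [largeSideList, LargeSideIndex.extra] at hp
    · simp only [largeSideList, Finset.inr_mem_disjSum, Finset.mem_map, Finset.mem_univ,
        true_and] at hp
      obtain ⟨i, rfl⟩ := hp
      exact Or.inr ⟨_, hγ i⟩
  · refine ⟨(γ, Sum.inr (⟨insert β U, hcard⟩, c)), ?_⟩
    rintro (p | c' | p) hp
    · exact hUused p (Finset.inl_mem_disjSum.1 hp)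
    · obtain rfl : c' = c := by simpa [largeSideList, LargeSideIndex.extra] using hp
      exact Or.inr ⟨_, h⟩
    · simp only [largeSideList, Finset.inr_mem_disjSum, Finset.mem_map, Finset.mem_univ,
        true_and] at hp
      obtain ⟨i, rfl⟩ := hp
      exact Or.inr ⟨_, hγ i⟩
  · simp [h, smallSideList] at hrow

theorem not_isChoosable_join_completeBipartiteGraph {s l m q a b : ℕ} (hl : 1 ≤ l)
    (ha : a = s + (1 + m)) (hk : m * q = l + s + 1)
    (hb : (m * q) ^ s * ((m * q).choose (l + 1) + (m * q).choose l * q) ≤ b) :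
    ¬ IsChoosable (graphJoin (⊤ : SimpleGraph (Fin (l - 1)))
      (completeBipartiteGraph (Fin a) (Fin b))) (l + s + 1) := by
  intro hch
  have ea : Fin a ≃ Fin s ⊕ (Unit ⊕ Fin m) := Fintype.equivOfCardEq (by simp [ha])
  have hcard : Fintype.card (LargeSideIndex s l m q) ≤ Fintype.card (Fin b) := by
    rw [card_largeSideIndex, Fintype.card_fin]; exact hb
  have hne : Nonempty (LargeSideIndex s l m q) := by
    rw [← Fintype.card_pos_iff, card_largeSideIndex]
    exact Nat.mul_pos (pow_pos (by omega) _)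
      (Nat.add_pos_left (Nat.choose_pos (by omega)) _)
  obtain ⟨e⟩ := Function.Embedding.nonempty_of_card_le hcard
  -- Every index labels some large-side vertex; surplus vertices repeat a list.
  have hsurj := Function.invFun_surjective e.injective
  set φ := Function.invFun e
  obtain ⟨g, hg, hadj⟩ := hch.exists_coloring (Γ := OhbaColor s m q)
    (Sum.elim (fun _ => (Finset.univ : Finset (Fin m × Fin q)).disjSum ∅)
      (Sum.elim (fun x => smallSideList s m q (ea x)) (fun y => largeSideList (φ y)))) (by
    rintro (u | x | y)
    · simp [hk]
    · simp [card_smallSideList, hk]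
    · simp [card_largeSideList])
  obtain ⟨t, ht⟩ := exists_largeSideList_used hl (fun i => g (Sum.inl i))
    (fun x => g (Sum.inr (Sum.inl (ea.symm x)))) (fun i => hg (Sum.inl i))
    (fun x => by simpa using hg (Sum.inr (Sum.inl (ea.symm x))))
    (fun i j hij => by
      by_contra hne
      exact hadj (Sum.inl i) (Sum.inl j) hne hij)
    (fun i x => hadj _ _ trivial)
  obtain ⟨y, rfl⟩ := hsurj t
  rcases ht _ (hg (Sum.inr (Sum.inr y))) with ⟨i, hi⟩ | ⟨x, hx⟩
  · exact hadj (Sum.inl i) (Sum.inr (Sum.inr y)) trivial hi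
  · exact hadj (Sum.inr (Sum.inl (ea.symm x))) (Sum.inr (Sum.inr y))
      (show (completeBipartiteGraph (Fin a) (Fin b)).Adj _ _ by simp) hx

end LowerBound

theorem mainTheorem6 (s l a b q : ℕ) (hl : 2 ≤ l) (ha : s + 2 < a)
    (hdvd : (a - s - 1) ∣ (l + s + 1))
    (hq : q = (l + s + 1) / (a - s - 1))
    (hab : a ≤ b)
    (hb : (l + s + 1) ^ s *
        (Nat.choose (l + s + 1) (l + 1) + Nat.choose (l + s + 1) l * q) ≤ b) :
    (l : ℕ∞) ≤ ohbaTau s a b := by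
  have hk : (a - s - 1) * q = l + s + 1 := by rw [hq]; exact Nat.mul_div_cancel' hdvd
  refine le_iInf₂ fun n hn => ?_
  by_contra hlt
  have hnl : n < l := by simpa using hlt
  have hch : IsChoosable (graphJoin (⊤ : SimpleGraph (Fin n))
      (completeBipartiteGraph (Fin a) (Fin b))) (n + 2 + s) := by
    apply isChoosable_of_listChromaticNumber_le
    refine le_trans hn ?_
    push_cast
    gcongr
    exact chromaticNumber_join_top_completeBipartiteGraph_le n _ _
  have hch' := hch.join_top_add (l - 1 - n)
  rw [show n + (l - 1 - n) = l - 1 by omega,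
    show n + 2 + s + (l - 1 - n) = l + s + 1 by omega] at hch'
  exact not_isChoosable_join_completeBipartiteGraph (m := a - s - 1) (q := q) (by omega)
    (by omega) hk (by rw [hk]; exact hb) hch'
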